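/- For an integer $r\ge 2$ let $f_r:\mathbb{R}\to\mathbb{R}$ be the Takagi–van der Waerden function $$f_r(x)=\sum_{n=0}^{\infty} r^{-n}\,\phi(r^n x),$$ where $\phi(x)=\operatorname{dist}(x,\mathbb{Z})$ is the distance from $x$ to the nearest integer, and for $y\in\mathbb{R}$ let $$L_r(y)=\{x\in[0,1): f_r(x)=y\}.$$ Then for every integer $r\ge 2$: (i) for Lebesgue-almost every $y\in\mathbb{R}$, the level set $L_r(y)$ is finite (possibly empty); (ii) for Lebesgue-almost every $x\in[0,1)$, the level set $L_r(f_r(x))$ is uncountable. -/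

import Mathlib

open MeasureTheory

namespace TakagiVdW

/-- The distance from `x` to the nearest integer, i.e. the distance from `x` to the set of
integers. -/
noncomputable def phi (x : ℝ) : ℝ :=
  Metric.infDist x (Set.range ((↑) : ℤ → ℝ))

/-- The Takagi-van der Waerden function `f_r(x) = ∑ r^{-n} φ(r^n x)`, the sum over `n ≥ 0`. -/
noncomputable def f (r : ℕ) (x : ℝ) : ℝ :=
  ∑' n : ℕ, ((r : ℝ) ^ n)⁻¹ * phi ((r : ℝ) ^ n * x)

/-- The level set of `f_r` at level `y` in `[0,1)`. -/
def levelSet (r : ℕ) (y : ℝ) : Set ℝ :=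
  {x : ℝ | x ∈ Set.Ico (0 : ℝ) 1 ∧ f r x = y}

theorem phi_nonneg (x : ℝ) : 0 ≤ phi x := Metric.infDist_nonneg

theorem phi_le_one (x : ℝ) : phi x ≤ 1 := by
  refine (Metric.infDist_le_dist_of_mem (Set.mem_range_self ⌊x⌋)).trans ?_
  rw [Real.dist_eq, abs_le]
  constructor <;> linarith [Int.floor_le x, Int.lt_floor_add_one x]

/-- The series defining `f_r` converges for `r ≥ 2`. -/
theorem summable_f (r : ℕ) (hr : 2 ≤ r) (x : ℝ) :
    Summable fun n : ℕ => ((r : ℝ) ^ n)⁻¹ * phi ((r : ℝ) ^ n * x) := by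
  have h2 : (2 : ℝ) ≤ r := by exact_mod_cast hr
  have hg : Summable fun n : ℕ => ((r : ℝ)⁻¹) ^ n :=
    summable_geometric_of_lt_one (by positivity) (inv_lt_one_of_one_lt₀ (by linarith))
  refine Summable.of_nonneg_of_le (fun n => mul_nonneg (by positivity) (phi_nonneg _))
    (fun n => ?_) hg
  rw [inv_pow]
  exact mul_le_of_le_one_right (by positivity) (phi_le_one _)

end TakagiVdW

/-! The slope of the n-th partial sum at `x` is a walk with steps ±1. On a cell where it vanishes,
`f r` is a constant plus r^{-n} f(r^n x). Since `f r` is even and 1-periodic, `x` can be reflected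
inside the cell, keeping its value and negating all later slopes (`exists_reflection`).

A zero-one law makes the walk almost surely unbounded in both directions, hence recurrent.
Reflecting at ever later zeros shows that the recurrent points of a level set accumulate at each of
themselves; their closure is perfect, which gives (ii).

For (i), the recurrent points have null image: reflection moves them, without changing values, to
points whose first n slopes are nonnegative. Cutting at the next zero bounds the measure of the
image by twice the measure of a set shrinking to a null set. So for a generic level every walk is
eventually of one sign. On points with slopes at least -N, `f r` decreases at most linearly
(`neg_mul_le_f_sub`), so a Lipschitz reparametrisation makes almost every level finite there.
Finally, an accumulation point of a generic level set is itself transient, and reflecting its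
neighbours brings them into one of these finite sets (`exists_isolating`), a contradiction. -/

namespace TakagiVdW

/-! ### The sawtooth and its half-cells -/

theorem phi_eq_min (x : ℝ) : phi x = min (Int.fract x) (1 - Int.fract x) := by
  rw [← abs_sub_round_eq_min]
  apply le_antisymm
  · rw [← Real.dist_eq]
    exact Metric.infDist_le_dist_of_mem (Set.mem_range_self _)
  · refine (Metric.le_infDist (Set.range_nonempty _)).2 ?_
    rintro _ ⟨z, rfl⟩
    rw [Real.dist_eq]
    exact round_le x z

theorem phi_add_intCast (x : ℝ) (m : ℤ) : phi (x + m) = phi x := by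
  simp [phi_eq_min]

theorem phi_neg (x : ℝ) : phi (-x) = phi x := by
  simp only [phi_eq_min]
  rcases eq_or_ne (Int.fract x) 0 with h | h
  · rw [h, Int.fract_neg_eq_zero.2 h]
  · rw [Int.fract_neg h, min_comm]
    congr 1
    ring

theorem phi_le_half (x : ℝ) : phi x ≤ 1 / 2 := by
  rw [phi_eq_min]
  rcases le_total (Int.fract x) (1 / 2) with h | h
  · exact (min_le_left _ _).trans h
  · exact (min_le_right _ _).trans (by linarith)

theorem fract_eq_sub_of_mem {x : ℝ} {m : ℤ} (h0 : (m : ℝ) ≤ x) (h1 : x < m + 1) :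
    Int.fract x = x - m := by
  rw [Int.fract, Int.floor_eq_iff.2 ⟨h0, h1⟩]

/-- The slope of `phi` to the right of `x`. -/
noncomputable def sg (x : ℝ) : ℤ := if Int.fract x < 1 / 2 then 1 else -1

theorem sg_eq_one_or (x : ℝ) : sg x = 1 ∨ sg x = -1 := by
  unfold sg; split_ifs <;> simp

theorem sg_eq_one {x : ℝ} {m : ℤ} (h0 : (m : ℝ) ≤ x) (h1 : x < m + 1 / 2) : sg x = 1 := by
  rw [sg, fract_eq_sub_of_mem h0 (by linarith), if_pos (by linarith)]

theorem sg_eq_neg_one {x : ℝ} {m : ℤ} (h0 : (m : ℝ) + 1 / 2 ≤ x) (h1 : x < m + 1) :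
    sg x = -1 := by
  rw [sg, fract_eq_sub_of_mem (by linarith) h1, if_neg (by linarith)]

theorem phi_of_left {x : ℝ} {m : ℤ} (h0 : (m : ℝ) ≤ x) (h1 : x ≤ m + 1 / 2) :
    phi x = x - m := by
  rw [phi_eq_min, fract_eq_sub_of_mem h0 (by linarith), min_eq_left (by linarith)]

theorem phi_of_right {x : ℝ} {m : ℤ} (h0 : (m : ℝ) + 1 / 2 ≤ x) (h1 : x ≤ m + 1) :
    phi x = m + 1 - x := by
  rcases h1.eq_or_lt with h | h
  · have h2 := phi_of_left (x := x) (m := m + 1) (by push_cast; linarith) (by push_cast; linarith)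
    rw [h2]; push_cast; linarith
  · rw [phi_eq_min, fract_eq_sub_of_mem (by linarith) h, min_eq_right (by linarith)]
    ring

theorem sg_add_intCast (x : ℝ) (m : ℤ) : sg (x + m) = sg x := by simp [sg]

/-- Every real lies in an interval `[m, m + 1/2)` or `[m + 1/2, m + 1)`. -/
theorem exists_half_cell (x : ℝ) : ∃ m : ℤ,
    (⌊2 * x⌋ = 2 * m ∧ (m : ℝ) ≤ x ∧ x < m + 1 / 2) ∨
    (⌊2 * x⌋ = 2 * m + 1 ∧ (m : ℝ) + 1 / 2 ≤ x ∧ x < m + 1) := by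
  have h1 := Int.floor_le (2 * x)
  have h2 := Int.lt_floor_add_one (2 * x)
  rcases Int.even_or_odd' ⌊2 * x⌋ with ⟨m, h | h⟩
  · refine ⟨m, Or.inl ⟨h, ?_, ?_⟩⟩ <;> rw [h] at h1 h2 <;> push_cast at h1 h2 <;> linarith
  · refine ⟨m, Or.inr ⟨h, ?_, ?_⟩⟩ <;> rw [h] at h1 h2 <;> push_cast at h1 h2 <;> linarith

theorem same_half_cell {x x' : ℝ} (h : ⌊2 * x⌋ = ⌊2 * x'⌋) :
    sg x' = sg x ∧ ⌊x⌋ = ⌊x'⌋ ∧ phi x' - phi x = sg x * (x' - x) := by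
  obtain ⟨m, ⟨e, a, b⟩ | ⟨e, a, b⟩⟩ := exists_half_cell x <;>
  obtain ⟨m', ⟨e', a', b'⟩ | ⟨e', a', b'⟩⟩ := exists_half_cell x'
  · obtain rfl : m = m' := by omega
    rw [sg_eq_one a b, sg_eq_one a' b', Int.floor_eq_iff.2 ⟨a, by linarith⟩,
      Int.floor_eq_iff.2 ⟨a', by linarith⟩, phi_of_left a b.le, phi_of_left a' b'.le]
    refine ⟨rfl, rfl, by push_cast; ring⟩
  · omega
  · omega
  · obtain rfl : m = m' := by omega
    rw [sg_eq_neg_one a b, sg_eq_neg_one a' b', Int.floor_eq_iff.2 ⟨by linarith, b⟩,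
      Int.floor_eq_iff.2 ⟨by linarith, b'⟩, phi_of_right a b.le, phi_of_right a' b'.le]
    refine ⟨rfl, rfl, by push_cast; ring⟩

theorem sg_neg {x : ℝ} (h : ∀ m : ℤ, 2 * x ≠ m) : sg (-x) = -sg x := by
  obtain ⟨m, ⟨-, a, b⟩ | ⟨-, a, b⟩⟩ := exists_half_cell x
  · have a' : (m : ℝ) < x := lt_of_le_of_ne a fun e => h (2 * m) (by push_cast; linarith)
    rw [sg_eq_one a b, sg_eq_neg_one (m := -m - 1)] <;> push_cast <;> linarith
  · have a' : (m : ℝ) + 1 / 2 < x :=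
      lt_of_le_of_ne a fun e => h (2 * m + 1) (by push_cast; linarith)
    rw [sg_eq_neg_one a b, sg_eq_one (m := -m - 1)] <;> push_cast <;> linarith

/-! ### Functional equation and symmetries of `f` -/

theorem f_nonneg (r : ℕ) (x : ℝ) : 0 ≤ f r x :=
  tsum_nonneg fun n => mul_nonneg (by positivity) (phi_nonneg _)

theorem f_eq (r : ℕ) (hr : 2 ≤ r) (x : ℝ) : f r x = phi x + (r : ℝ)⁻¹ * f r (r * x) := by
  unfold f
  rw [(summable_f r hr x).tsum_eq_zero_add, ← tsum_mul_left]
  congr 1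
  · simp
  · refine tsum_congr fun n => ?_
    rw [pow_succ, mul_inv, mul_comm ((r : ℝ) ^ n)⁻¹, mul_assoc, mul_assoc]

theorem f_le_one (r : ℕ) (hr : 2 ≤ r) (x : ℝ) : f r x ≤ 1 := by
  have hg := hasSum_geometric_of_lt_one (r := (1 / 2 : ℝ)) (by norm_num) (by norm_num)
  have hg' := hg.mul_left (1 / 2 : ℝ)
  have h2 : (2 : ℝ) ≤ r := by exact_mod_cast hr
  refine ((summable_f r hr x).tsum_le_tsum (fun n => ?_) hg'.summable).trans
    (hg'.tsum_eq.trans_le (by norm_num))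
  have : ((r : ℝ) ^ n)⁻¹ ≤ (1 / 2) ^ n := by
    rw [one_div, inv_pow]
    exact inv_anti₀ (by positivity) (pow_le_pow_left₀ (by norm_num) h2 n)
  rw [mul_comm (1 / 2 : ℝ)]
  exact mul_le_mul this (phi_le_half _) (phi_nonneg _) (by positivity)

theorem f_add_intCast (r : ℕ) (x : ℝ) (m : ℤ) : f r (x + m) = f r x := by
  unfold f
  refine tsum_congr fun n => ?_
  have := phi_add_intCast ((r : ℝ) ^ n * x) (r ^ n * m)
  push_cast at this
  rw [mul_add, this]

theorem f_neg (r : ℕ) (x : ℝ) : f r (-x) = f r x := by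
  unfold f
  refine tsum_congr fun n => ?_
  rw [mul_neg, phi_neg]

theorem continuous_f (r : ℕ) (hr : 2 ≤ r) : Continuous (f r) := by
  have h2 : (2 : ℝ) ≤ r := by exact_mod_cast hr
  have hg : Summable fun n : ℕ => ((r : ℝ)⁻¹) ^ n :=
    summable_geometric_of_lt_one (by positivity) (inv_lt_one_of_one_lt₀ (by linarith))
  refine continuous_tsum (fun n => ?_) hg fun n x => ?_
  · exact continuous_const.mul
      ((Metric.continuous_infDist_pt _).comp (continuous_const.mul continuous_id))
  · rw [Real.norm_of_nonneg (mul_nonneg (by positivity) (phi_nonneg _)), inv_pow]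
    exact mul_le_of_le_one_right (by positivity) (phi_le_one _)

/-! ### Slopes, grid points and cells -/

/-- The slope at `x` of the partial sum of the first `n` terms of `f r`. -/
noncomputable def slope (r n : ℕ) (x : ℝ) : ℤ := ∑ k ∈ Finset.range n, sg ((r : ℝ) ^ k * x)

theorem slope_zero (r : ℕ) (x : ℝ) : slope r 0 x = 0 := rfl

theorem slope_succ (r n : ℕ) (x : ℝ) :
    slope r (n + 1) x = slope r n x + sg ((r : ℝ) ^ n * x) :=
  Finset.sum_range_succ _ _

theorem slope_add (r n j : ℕ) (x : ℝ) :
    slope r (n + j) x = slope r n x + slope r j ((r : ℝ) ^ n * x) := by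
  unfold slope
  rw [Finset.sum_range_add]
  congr 1
  refine Finset.sum_congr rfl fun k _ => ?_
  rw [pow_add, mul_comm ((r : ℝ) ^ n), mul_assoc]

theorem slope_succ' (r n : ℕ) (x : ℝ) : slope r (n + 1) x = sg x + slope r n (r * x) := by
  rw [add_comm n 1, slope_add]
  simp [slope]

theorem slope_add_intCast (r n : ℕ) (x : ℝ) (m : ℤ) : slope r n (x + m) = slope r n x := by
  refine Finset.sum_congr rfl fun k _ => ?_
  have := sg_add_intCast ((r : ℝ) ^ k * x) (r ^ k * m)
  push_cast at this
  rw [mul_add, this]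

/-- `x` is not an endpoint of an interval of linearity of a partial sum of `f r`. -/
def NonGrid (r : ℕ) (x : ℝ) : Prop := ∀ (n : ℕ) (m : ℤ), 2 * ((r : ℝ) ^ n * x) ≠ m

theorem slope_neg {r : ℕ} {x : ℝ} (h : NonGrid r x) (n : ℕ) : slope r n (-x) = -slope r n x := by
  unfold slope
  rw [← Finset.sum_neg_distrib]
  refine Finset.sum_congr rfl fun k _ => ?_
  rw [mul_neg, sg_neg (h k)]

theorem NonGrid.neg {r : ℕ} {x : ℝ} (h : NonGrid r x) : NonGrid r (-x) := fun n m e =>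
  h n (-m) (by push_cast; linarith)

theorem NonGrid.add_intCast {r : ℕ} {x : ℝ} (h : NonGrid r x) (m : ℤ) : NonGrid r (x + m) :=
  fun n k e => h n (k - 2 * r ^ n * m) (by push_cast; linarith)

theorem NonGrid.pow_mul {r : ℕ} {x : ℝ} (h : NonGrid r x) (k : ℕ) :
    NonGrid r ((r : ℝ) ^ k * x) := fun n m e =>
  h (n + k) m (by rw [← e, pow_add]; ring)

theorem NonGrid.mul {r : ℕ} {x : ℝ} (h : NonGrid r x) : NonGrid r ((r : ℝ) * x) := by
  simpa using h.pow_mul 1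

theorem NonGrid.of_pow_mul {r : ℕ} {x : ℝ} {k : ℕ} (h : NonGrid r ((r : ℝ) ^ k * x)) :
    NonGrid r x := fun n m e =>
  h n (r ^ k * m) (by push_cast; rw [← e]; ring)

theorem countable_not_nonGrid (r : ℕ) (hr : 2 ≤ r) : {x | ¬ NonGrid r x}.Countable := by
  have : {x | ¬ NonGrid r x} ⊆ ⋃ (n : ℕ) (m : ℤ), {(m : ℝ) / (2 * (r : ℝ) ^ n)} := by
    intro x hx
    simp only [NonGrid, Set.mem_ofPred_eq, not_forall, not_not] at hx
    obtain ⟨n, m, e⟩ := hx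
    have : (0 : ℝ) < r := by exact_mod_cast (by omega : 0 < r)
    simp only [Set.mem_iUnion, Set.mem_singleton_iff]
    refine ⟨n, m, ?_⟩
    rw [← e]
    field_simp
  exact (Set.countable_iUnion fun n => Set.countable_iUnion fun m =>
    Set.countable_singleton _).mono this

/-- Two points lie in the same interval of linearity of the partial sum of the first `n` terms
of `f r`. -/
def SameCell (r n : ℕ) (x x' : ℝ) : Prop :=
  ⌊x⌋ = ⌊x'⌋ ∧ ∀ k < n, ⌊2 * ((r : ℝ) ^ k * x)⌋ = ⌊2 * ((r : ℝ) ^ k * x')⌋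

theorem SameCell.refl (r n : ℕ) (x : ℝ) : SameCell r n x x := ⟨rfl, fun _ _ => rfl⟩

theorem SameCell.symm {r n : ℕ} {x y : ℝ} (h : SameCell r n x y) : SameCell r n y x :=
  ⟨h.1.symm, fun k hk => (h.2 k hk).symm⟩

theorem SameCell.trans {r n : ℕ} {x y z : ℝ} (h : SameCell r n x y) (h' : SameCell r n y z) :
    SameCell r n x z := ⟨h.1.trans h'.1, fun k hk => (h.2 k hk).trans (h'.2 k hk)⟩

theorem SameCell.mono {r n m : ℕ} {x y : ℝ} (h : SameCell r n x y) (hm : m ≤ n) :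
    SameCell r m x y := ⟨h.1, fun k hk => h.2 k (by omega)⟩

theorem SameCell.slope_eq {r n : ℕ} {x x' : ℝ} (h : SameCell r n x x') {j : ℕ} (hj : j ≤ n) :
    slope r j x' = slope r j x :=
  Finset.sum_congr rfl fun k hk =>
    (same_half_cell (h.2 k (by have := Finset.mem_range.1 hk; omega))).1

/-- Self-similarity: the first n terms are affine on the cell, and the remaining ones sum to a
rescaled copy of `f r`. -/
theorem SameCell.f_sub {r n : ℕ} (hr : 2 ≤ r) {x x' : ℝ} (h : SameCell r n x x') :
    f r x' - f r x = slope r n x * (x' - x) +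
      ((r : ℝ) ^ n)⁻¹ * (f r ((r : ℝ) ^ n * x') - f r ((r : ℝ) ^ n * x)) := by
  have hr0 : (r : ℝ) ≠ 0 := by exact_mod_cast (by omega : r ≠ 0)
  induction n with
  | zero => simp [slope_zero]
  | succ n ih =>
    rw [ih (h.mono n.le_succ), f_eq r hr ((r : ℝ) ^ n * x'), f_eq r hr ((r : ℝ) ^ n * x), slope_succ]
    have := (same_half_cell (h.2 n n.lt_succ_self)).2.2
    have e : ∀ z : ℝ, (r : ℝ) * ((r : ℝ) ^ n * z) = (r : ℝ) ^ (n + 1) * z := fun z => by ring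
    rw [e, e]
    have e2 : phi ((r : ℝ) ^ n * x') = phi ((r : ℝ) ^ n * x) + sg ((r : ℝ) ^ n * x) *
      ((r : ℝ) ^ n * x' - (r : ℝ) ^ n * x) := by linarith
    rw [e2]
    push_cast
    field_simp
    ring

theorem SameCell.dist_le {r n : ℕ} (hr : 2 ≤ r) {x x' : ℝ} (h : SameCell r n x x') :
    |x' - x| ≤ (r : ℝ) * ((r : ℝ) ^ n)⁻¹ := by
  have h2 : (2 : ℝ) ≤ r := by exact_mod_cast hr
  rcases n with _ | n
  · have := Int.abs_sub_lt_one_of_floor_eq_floor h.1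
    rw [abs_sub_comm]
    simp only [pow_zero, inv_one, mul_one]
    linarith
  · have := Int.abs_sub_lt_one_of_floor_eq_floor (h.2 n n.lt_succ_self)
    rw [← mul_sub, ← mul_sub, abs_mul, abs_mul, abs_sub_comm, abs_of_pos (by positivity : (0:ℝ) < r ^ n),
      abs_two] at this
    have e : (r : ℝ) * ((r : ℝ) ^ (n + 1))⁻¹ = ((r : ℝ) ^ n)⁻¹ := by
      rw [pow_succ]; field_simp
    rw [e, ← one_div, le_div_iff₀ (by positivity)]
    have h0 := mul_nonneg (by positivity : (0:ℝ) ≤ r ^ n) (abs_nonneg (x' - x))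
    linarith

/-- Agreement of one level of the grid implies agreement of all coarser levels. -/
theorem sameCell_succ {r n : ℕ} (hr : 2 ≤ r) {x x' : ℝ}
    (h : ⌊2 * ((r : ℝ) ^ n * x)⌋ = ⌊2 * ((r : ℝ) ^ n * x')⌋) : SameCell r (n + 1) x x' := by
  have h2 : (r : ℝ) ≠ 0 := by exact_mod_cast (by omega : r ≠ 0)
  have key : ∀ k ≤ n, ⌊2 * ((r : ℝ) ^ k * x)⌋ = ⌊2 * ((r : ℝ) ^ k * x')⌋ := by
    intro k hk
    have e : ∀ z : ℝ, 2 * ((r : ℝ) ^ k * z) = 2 * ((r : ℝ) ^ n * z) / ((r ^ (n - k) : ℕ) : ℝ) := by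
      intro z
      rw [eq_div_iff (by push_cast; positivity)]
      push_cast
      have : (r : ℝ) ^ n = (r : ℝ) ^ k * (r : ℝ) ^ (n - k) := by
        rw [← pow_add]; congr 1; omega
      rw [this]; ring
    rw [e, e, Int.floor_div_natCast, Int.floor_div_natCast, h]
  refine ⟨?_, fun k hk => key k (by omega)⟩
  have := key 0 (Nat.zero_le _)
  simp only [pow_zero, one_mul] at this
  exact (same_half_cell this).2.1

/-- Points close to a point off the grid lie in the same cell. -/
theorem exists_sameCell {r : ℕ} (hr : 2 ≤ r) {x : ℝ} (h : NonGrid r x) (n : ℕ) :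
    ∃ ε > 0, ∀ x', |x' - x| < ε → SameCell r n x x' := by
  have hr0 : (0 : ℝ) < r := by exact_mod_cast (by omega : 0 < r)
  set t := 2 * ((r : ℝ) ^ n * x) with ht
  have h1 : (⌊t⌋ : ℝ) < t := lt_of_le_of_ne (Int.floor_le t) (h n ⌊t⌋).symm
  have h3 := Int.lt_floor_add_one t
  refine ⟨min (t - ⌊t⌋) (⌊t⌋ + 1 - t) / (2 * (r : ℝ) ^ n), by
    have : 0 < min (t - ⌊t⌋) (⌊t⌋ + 1 - t) := lt_min (by linarith) (by linarith)
    positivity, fun x' hx' => ?_⟩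
  refine (sameCell_succ hr (n := n) ?_).mono n.le_succ
  rw [lt_div_iff₀ (by positivity)] at hx'
  have e : |x' - x| * (2 * (r : ℝ) ^ n) = |2 * ((r : ℝ) ^ n * x') - t| := by
    rw [ht, ← mul_sub, ← mul_sub, abs_mul, abs_mul, abs_two, abs_of_pos (by positivity : (0:ℝ) < r ^ n),
      mul_comm, mul_assoc]
  rw [e] at hx'
  have a1 := abs_lt.1 (hx'.trans_le (min_le_left _ _))
  have a2 := abs_lt.1 (hx'.trans_le (min_le_right _ _))
  exact (Int.floor_eq_iff.2 ⟨by linarith, by linarith⟩).symm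

/-! ### The ±1 walk and reflection at its zeros -/

theorem slope_succ_eq (r n : ℕ) (x : ℝ) :
    slope r (n + 1) x = slope r n x + 1 ∨ slope r (n + 1) x = slope r n x - 1 := by
  rw [slope_succ]
  rcases sg_eq_one_or ((r : ℝ) ^ n * x) with h | h <;> rw [h]
  · exact Or.inl rfl
  · exact Or.inr rfl

/-- At a zero of the slope a point can be replaced by one with the same value and with the
opposite slopes from then on. -/
theorem exists_reflection {r : ℕ} (hr : 2 ≤ r) {x : ℝ} (hx : NonGrid r x) {n : ℕ}
    (h0 : slope r n x = 0) : ∃ x', SameCell r n x x' ∧ NonGrid r x' ∧ f r x' = f r x ∧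
      ∀ j, slope r (n + j) x' = -slope r (n + j) x := by
  have h2 : (2 : ℝ) ≤ r := by exact_mod_cast hr
  -- In the coordinate r^n x a cell of order n has length 1 (n = 0) or r/2 ≥ 1, so it contains a
  -- representative of -r^n x modulo 1.
  obtain ⟨x', k, hc, e⟩ : ∃ (x' : ℝ) (k : ℤ), SameCell r n x x' ∧
      (r : ℝ) ^ n * x' = -((r : ℝ) ^ n * x) + k := by
    rcases n with _ | n
    · refine ⟨⌊x⌋ + Int.fract (-x), ⌊x⌋ - ⌊-x⌋, ⟨?_, fun k hk => by omega⟩, ?_⟩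
      · rw [Int.floor_intCast_add, Int.floor_fract, add_zero]
      · rw [Int.fract]; push_cast; ring
    · set i := ⌊2 * ((r : ℝ) ^ n * x)⌋ with hi
      set c : ℝ := i * r / 2 with hc
      set u := (r : ℝ) ^ (n + 1) * x with hu
      have hf0 := Int.fract_nonneg (-u - c)
      have hf1 := Int.fract_lt_one (-u - c)
      refine ⟨(c + Int.fract (-u - c)) / (r : ℝ) ^ (n + 1), -⌊-u - c⌋,
        sameCell_succ hr ?_, ?_⟩
      · rw [← hi, eq_comm, Int.floor_eq_iff]
        have : 2 * ((r : ℝ) ^ n * ((c + Int.fract (-u - c)) / (r : ℝ) ^ (n + 1))) =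
            i + 2 * Int.fract (-u - c) / r := by
          rw [hc, pow_succ]
          field_simp
        rw [this]
        refine ⟨le_add_of_nonneg_right (by positivity), ?_⟩
        have : 2 * Int.fract (-u - c) / r < 1 := by
          rw [div_lt_one (by positivity)]; linarith
        linarith
      · rw [mul_div_cancel₀ _ (by positivity), Int.fract]; push_cast; ring
  have hn : NonGrid r x' := by
    refine NonGrid.of_pow_mul (k := n) ?_
    rw [e]
    exact (hx.pow_mul n).neg.add_intCast k
  refine ⟨x', hc, hn, ?_, fun j => ?_⟩
  · have := hc.f_sub hr
    rw [h0, e, f_add_intCast, f_neg] at this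
    simp only [Int.cast_zero, zero_mul, sub_self, mul_zero, add_zero] at this
    linarith
  · rw [slope_add, slope_add, hc.slope_eq le_rfl, h0, e, slope_add_intCast,
      slope_neg (hx.pow_mul n)]
    ring

/-- Reflecting at successive zeros makes the slopes nonnegative on a given range. -/
theorem exists_nonneg_slope {r : ℕ} (hr : 2 ≤ r) {x : ℝ} (hx : NonGrid r x) {N : ℕ}
    (hN : 0 ≤ slope r N x) {n : ℕ} (hn : N ≤ n) : ∃ x', SameCell r N x x' ∧ NonGrid r x' ∧
      f r x' = f r x ∧ (∀ j, |slope r j x'| = |slope r j x|) ∧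
      ∀ j, N ≤ j → j ≤ n → 0 ≤ slope r j x' := by
  induction n, hn using Nat.le_induction with
  | base =>
    refine ⟨x, SameCell.refl _ _ _, hx, rfl, fun _ => rfl, fun j h1 h2 => ?_⟩
    obtain rfl : j = N := by omega
    exact hN
  | succ n hn ih =>
    obtain ⟨x₁, hc, hx₁, hf, hs, hp⟩ := ih
    by_cases h : 0 ≤ slope r (n + 1) x₁
    · refine ⟨x₁, hc, hx₁, hf, hs, fun j h1 h2 => ?_⟩
      rcases h2.eq_or_lt with rfl | h3
      · exact h
      · exact hp j h1 (by omega)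
    -- A ±1 walk turns negative only from zero, so reflecting there repairs the sign.
    · have h0 : slope r n x₁ = 0 := by
        have := hp n hn le_rfl
        rcases slope_succ_eq r n x₁ with e | e <;> omega
      obtain ⟨x₂, hc₂, hx₂, hf₂, hs₂⟩ := exists_reflection hr hx₁ h0
      refine ⟨x₂, hc.trans (hc₂.mono hn), hx₂, hf₂.trans hf, fun j => ?_, fun j h1 h2 => ?_⟩
      · rw [← hs j]
        rcases le_total j n with hj | hj
        · rw [hc₂.slope_eq hj]
        · obtain ⟨k, rfl⟩ := Nat.exists_eq_add_of_le hj
          rw [hs₂, abs_neg]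
      · rcases h2.eq_or_lt with rfl | h3
        · rw [hs₂]; omega
        · rw [hc₂.slope_eq (by omega : j ≤ n)]
          exact hp j h1 (by omega)

/-! ### One-sided Lipschitz bound -/

/-- While `a` is below 1/2, passing to `r * a` adds `a` to the bound and costs the walk of `-a` one
unit of its budget `s`. So 1/2 is reached within `s` steps, where `f r ≤ 1` contributes the
remaining `2 * a`. -/
theorem f_le_of_slope {r : ℕ} (hr : 2 ≤ r) (s : ℕ) : ∀ a : ℝ, 0 ≤ a → NonGrid r a →
    (∀ j, 0 ≤ s + slope r j (-a)) → f r a ≤ (s + 2) * a := by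
  have h2 : (2 : ℝ) ≤ r := by exact_mod_cast hr
  induction s with
  | zero =>
    intro a ha hg hs
    rcases le_or_gt (1 / 2) a with h | h
    · have := f_le_one r hr a
      push_cast; linarith
    · exfalso
      have ha' : 0 < a := lt_of_le_of_ne ha fun e => hg 0 0 (by simp [← e])
      have := hs 1
      rw [slope_succ, slope_zero, pow_zero, one_mul,
        sg_eq_neg_one (m := -1) (by push_cast; linarith) (by push_cast; linarith)] at this
      norm_num at this
  | succ s ih =>
    intro a ha hg hs
    rcases le_or_gt (1 / 2) a with h | h
    · have := f_le_one r hr a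
      push_cast
      nlinarith [(Nat.cast_nonneg s : (0 : ℝ) ≤ s)]
    · have ha' : 0 < a := lt_of_le_of_ne ha fun e => hg 0 0 (by simp [← e])
      have key := ih (r * a) (by positivity) hg.mul fun j => by
        have := hs (j + 1)
        rw [slope_succ', sg_eq_neg_one (m := -1) (by push_cast; linarith) (by push_cast; linarith),
          mul_neg] at this
        push_cast at this
        linarith
      have hp : phi a = a := by
        rw [phi_of_left (m := 0) (by simpa using ha) (by push_cast; linarith)]; simp
      rw [f_eq r hr, hp]
      have : (r : ℝ)⁻¹ * f r (r * a) ≤ (r : ℝ)⁻¹ * ((s + 2) * (r * a)) := by gcongr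
      have e : (r : ℝ)⁻¹ * ((s + 2) * (r * a)) = (s + 2) * a := by field_simp
      push_cast
      linarith

theorem odd_mul_half_add {r : ℕ} (hr : Odd r) (b : ℝ) :
    ∃ q : ℤ, (r : ℝ) * (1 / 2 + b) = (1 / 2 + r * b) + q := by
  obtain ⟨q, rfl⟩ := hr
  exact ⟨q, by push_cast; ring⟩

/-- The same budget argument at the peak: for odd `r`, the point 1/2 is fixed modulo 1 by
multiplication by `r`, and the slope just to its right is -1. -/
theorem f_half_sub_le_of_slope {r : ℕ} (hr : 2 ≤ r) (ho : Odd r) (s : ℕ) : ∀ b : ℝ, 0 ≤ b →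
    (∀ j, 0 ≤ s + slope r j (1 / 2 + b)) → f r (1 / 2) - (s + 2) * b ≤ f r (1 / 2 + b) := by
  have h2 : (2 : ℝ) ≤ r := by exact_mod_cast hr
  induction s with
  | zero =>
    intro b hb hs
    rcases le_or_gt (1 / 2) b with h | h
    · have := f_le_one r hr (1 / 2)
      have := f_nonneg r (1 / 2 + b)
      push_cast; linarith
    · exfalso
      have := hs 1
      rw [slope_succ, slope_zero, pow_zero, one_mul,
        sg_eq_neg_one (m := 0) (by push_cast; linarith) (by push_cast; linarith)] at this
      norm_num at this
  | succ s ih =>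
    intro b hb hs
    rcases le_or_gt (1 / 2) b with h | h
    · have := f_le_one r hr (1 / 2)
      have := f_nonneg r (1 / 2 + b)
      push_cast
      nlinarith [(Nat.cast_nonneg s : (0 : ℝ) ≤ s)]
    · obtain ⟨q, hq⟩ := odd_mul_half_add ho b
      obtain ⟨q', hq'⟩ := odd_mul_half_add ho 0
      have key := ih (r * b) (by positivity) fun j => by
        have := hs (j + 1)
        rw [slope_succ', sg_eq_neg_one (m := 0) (by push_cast; linarith) (by push_cast; linarith),
          hq, slope_add_intCast] at this
        push_cast at this
        linarith
      rw [f_eq r hr (1 / 2 + b), f_eq r hr (1 / 2), hq, f_add_intCast,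
        phi_of_right (m := 0) (by push_cast; linarith) (by push_cast; linarith),
        phi_of_right (m := 0) (by push_cast; linarith) (by push_cast; linarith)]
      rw [add_zero, mul_zero, add_zero] at hq'
      rw [hq', f_add_intCast]
      have : (r : ℝ)⁻¹ * (f r (1 / 2) - (s + 2) * (r * b)) ≤ (r : ℝ)⁻¹ * f r (1 / 2 + r * b) := by
        gcongr
      have e : (r : ℝ)⁻¹ * (f r (1 / 2) - (s + 2) * (r * b)) =
        (r : ℝ)⁻¹ * f r (1 / 2) - (s + 2) * b := by field_simp
      push_cast
      linarith

theorem f_le_f_half {r : ℕ} (hr : 2 ≤ r) (ho : Odd r) (x : ℝ) : f r x ≤ f r (1 / 2) := by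
  refine (summable_f r hr x).tsum_le_tsum (fun n => ?_) (summable_f r hr _)
  have : phi ((r : ℝ) ^ n * (1 / 2)) = 1 / 2 := by
    obtain ⟨q, hq⟩ := ho.pow (n := n)
    have e : (r : ℝ) ^ n * (1 / 2) = 1 / 2 + (q : ℤ) := by
      rw [← Nat.cast_pow, hq]; push_cast; ring
    rw [e, phi_add_intCast, phi_of_left (m := 0) (by norm_num) (by norm_num)]
    norm_num
  rw [this]
  gcongr
  exact phi_le_half _

/-- On the set of points whose slopes are bounded below, `f r` decreases at most linearly. -/
theorem neg_mul_le_f_sub {r : ℕ} (hr : 2 ≤ r) (n : ℕ) : ∀ (s : ℤ) (u u' : ℝ), NonGrid r u →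
    NonGrid r u' → u < u' → 1 / 2 ≤ (r : ℝ) ^ n * (u' - u) → (∀ j, 0 ≤ s + slope r j u) →
    (∀ j, 0 ≤ s + slope r j u') → -((s + 2) * (u' - u)) ≤ f r u' - f r u := by
  have h2 : (2 : ℝ) ≤ r := by exact_mod_cast hr
  -- At distance at least 1/2 the bound 0 ≤ `f r` ≤ 1 suffices; `n` counts the rescalings needed to
  -- get there.
  have far : ∀ (s : ℤ) (u u' : ℝ), 1 / 2 ≤ u' - u → (∀ j, 0 ≤ s + slope r j u) →
      -((s + 2) * (u' - u)) ≤ f r u' - f r u := by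
    intro s u u' h hs
    have hs0 : (0 : ℝ) ≤ s := by
      have := hs 0
      rw [slope_zero, add_zero] at this
      exact_mod_cast this
    have := f_le_one r hr u
    have := f_nonneg r u'
    nlinarith
  induction n with
  | zero => intro s u u' _ _ _ h hs _; exact far s u u' (by simpa using h) hs
  | succ n ih =>
    intro s u u' hu hu' hlt hd hs hs'
    rcases le_or_gt (1 / 2) (u' - u) with h | h
    · exact far s u u' h hs
    obtain ⟨s, rfl⟩ : ∃ t : ℕ, s = t := Int.eq_ofNat_of_zero_le (by simpa [slope_zero] using hs 0)
    have hs0 : (0 : ℝ) ≤ s := Nat.cast_nonneg s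
    rw [Int.cast_natCast]
    have hm : ⌊2 * u⌋ ≤ ⌊2 * u'⌋ := Int.floor_le_floor (by linarith)
    have hm' : ⌊2 * u'⌋ ≤ ⌊2 * u⌋ + 1 := by
      rw [← Int.floor_add_one]; exact Int.floor_le_floor (by linarith)
    rcases hm.eq_or_lt with he | hne
    -- No breakpoint in between: rescale by `r`, with the first slope absorbed into `s`.
    · obtain ⟨hsg, -, hphi⟩ := same_half_cell he
      have key := ih (s + sg u) (r * u) (r * u') hu.mul hu'.mul (by gcongr)
        (by rw [← mul_sub, ← mul_assoc, ← pow_succ]; exact hd)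
        (fun j => by have := hs (j + 1); rw [slope_succ'] at this; linarith)
        (fun j => by have := hs' (j + 1); rw [slope_succ', hsg] at this; linarith)
      rw [f_eq r hr u', f_eq r hr u]
      have k2 := mul_le_mul_of_nonneg_left key (by positivity : (0:ℝ) ≤ (r : ℝ)⁻¹)
      have e : (r : ℝ)⁻¹ * -((((s + sg u : ℤ) : ℝ) + 2) * (r * u' - r * u)) =
        -((s + sg u + 2) * (u' - u)) := by push_cast; field_simp
      rw [e] at k2
      nlinarith
    · obtain ⟨m, ⟨e, a, b⟩ | ⟨e, a, b⟩⟩ := exists_half_cell u <;>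
      obtain ⟨m', ⟨e', a', b'⟩ | ⟨e', a', b'⟩⟩ := exists_half_cell u'
      · omega
      · obtain rfl : m = m' := by omega
        -- A half-integer separates the points. For even `r` it becomes an integer, a minimum of `f
        -- r`, after one rescaling; for odd `r` it is a global maximum.
        rcases Nat.even_or_odd' r with ⟨q, hq | hq⟩
        · have hqr : (r : ℝ) = 2 * q := by rw [hq]; push_cast; ring
          have eu : (r : ℝ) * u = -(r * (m + 1 / 2 - u)) + ((q * (2 * m + 1) : ℤ) : ℝ) := by
            push_cast; rw [hqr]; ring
          have eu' : (r : ℝ) * (m + 1 / 2 - u) = -(r * u) + ((q * (2 * m + 1) : ℤ) : ℝ) := by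
            rw [eu]; ring
          have key := f_le_of_slope hr (s + 1) (r * (m + 1 / 2 - u))
            (mul_nonneg (by positivity) (by linarith))
            (by rw [eu']; exact hu.mul.neg.add_intCast _) fun j => by
              have := hs (j + 1)
              rw [slope_succ', sg_eq_one a b, eu, slope_add_intCast] at this
              push_cast
              linarith
          rw [f_eq r hr u', f_eq r hr u, phi_of_left a b.le, phi_of_right a' b'.le]
          have e1 : f r (r * u) = f r (r * (m + 1 / 2 - u)) := by
            rw [eu, f_add_intCast, f_neg]
          rw [e1]
          have k2 := mul_le_mul_of_nonneg_left key (by positivity : (0:ℝ) ≤ (r : ℝ)⁻¹)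
          have e2 : (r : ℝ)⁻¹ * (((s + 1 : ℕ) + 2) * (r * (m + 1 / 2 - u))) =
            (s + 3) * (m + 1 / 2 - u) := by push_cast; field_simp; ring
          rw [e2] at k2
          have : 0 ≤ (r : ℝ)⁻¹ * f r (r * u') := mul_nonneg (by positivity) (f_nonneg _ _)
          nlinarith
        · have ho : Odd r := ⟨q, hq⟩
          have eu : u' = 1 / 2 + (u' - m - 1 / 2) + m := by ring
          have key := f_half_sub_le_of_slope hr ho s (u' - m - 1 / 2) (by linarith) fun j => by
            have := hs' j
            rw [eu, slope_add_intCast] at this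
            exact this
          rw [← f_add_intCast r (1 / 2 + (u' - m - 1 / 2)) m, ← eu] at key
          have := f_le_f_half hr ho u
          nlinarith
      -- An integer separates the points: `f r u'` is nonnegative and `f r u` is at most linear in
      -- the distance to that integer.
      · have hmm : m' = m + 1 := by omega
        subst hmm
        push_cast at a' b'
        have eu : u = -(m + 1 - u) + ((m + 1 : ℤ) : ℝ) := by push_cast; ring
        have eu' : m + 1 - u = -u + ((m + 1 : ℤ) : ℝ) := by push_cast; ring
        have key := f_le_of_slope hr s (m + 1 - u) (by linarith)
          (by rw [eu']; exact hu.neg.add_intCast _) fun j => by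
            have := hs j
            rw [eu, slope_add_intCast] at this
            exact this
        have e1 : f r u = f r (m + 1 - u) := by rw [eu', f_add_intCast, f_neg]
        have := f_nonneg r u'
        rw [e1]
        nlinarith
      · omega

/-! ### Finiteness of generic level sets on the line -/

/-- Almost every level set of a Lipschitz function on a compact interval is finite. -/
theorem LipschitzWith.ae_finite_level {K : NNReal} {ψ : ℝ → ℝ} (hψ : LipschitzWith K ψ)
    (a b : ℝ) : ∀ᵐ y : ℝ, (Set.Icc a b ∩ {t | ψ t = y}).Finite := by
  set N := {t | ¬ DifferentiableAt ℝ ψ t} with hN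
  set D := {t | DifferentiableAt ℝ ψ t ∧ deriv ψ t = 0} with hD
  have h1 : volume (ψ '' N) = 0 := by
    have h0 : volume N = 0 := hψ.ae_differentiableAt_real
    have := hψ.hausdorffMeasure_image_le (d := 1) zero_le_one N
    rw [hausdorffMeasure_real, h0, mul_zero] at this
    exact le_antisymm this zero_le
  have h2 : volume (ψ '' D) = 0 := by
    refine addHaar_image_eq_zero_of_det_fderivWithin_eq_zero (f' := fun _ => 0) volume ?_ ?_
    · rintro t ⟨ht, h0⟩
      have := ht.hasDerivAt.hasFDerivAt.hasFDerivWithinAt (s := D)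
      rw [h0, ContinuousLinearMap.toSpanSingleton_zero] at this
      exact this
    · intro t _
      simp [ContinuousLinearMap.det]
  -- At a level avoiding both null images every point has a nonzero derivative and is therefore
  -- isolated.
  filter_upwards [measure_eq_zero_iff_ae_notMem.1 h1, measure_eq_zero_iff_ae_notMem.1 h2]
    with y hy1 hy2
  by_contra hinf
  obtain ⟨t, ht, hacc⟩ := Set.Infinite.exists_accPt_of_subset_isCompact hinf isCompact_Icc
    Set.inter_subset_left
  have hc : IsClosed {t | ψ t = y} := isClosed_eq hψ.continuous continuous_const
  have hty : ψ t = y := hc.closure_subset_iff.2 Set.inter_subset_right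
    (mem_closure_iff_clusterPt.2 hacc.clusterPt)
  have hdiff : DifferentiableAt ℝ ψ t := by
    by_contra h
    exact hy1 ⟨t, h, hty⟩
  have hd0 : deriv ψ t ≠ 0 := fun h => hy2 ⟨t, ⟨hdiff, h⟩, hty⟩
  have hev := hdiff.hasDerivAt.eventually_ne (c := y) hd0
  rw [accPt_iff_frequently_nhdsNE] at hacc
  obtain ⟨z, hz, hz'⟩ := (hacc.and_eventually hev).exists
  exact hz' hz.2

/-- Almost every level set of a bounded function that decreases at most linearly on a bounded set
is finite. -/
theorem ae_finite_level_of_neg_mul_le {A : Set ℝ} {g : ℝ → ℝ} {a b M C : ℝ} (hC : 0 ≤ C)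
    (hA : A ⊆ Set.Icc a b) (hg : ∀ x ∈ A, |g x| ≤ M)
    (h : ∀ x ∈ A, ∀ x' ∈ A, x < x' → -(C * (x' - x)) ≤ g x' - g x) :
    ∀ᵐ y : ℝ, (A ∩ {x | g x = y}).Finite := by
  -- The slope `C + 1` makes `T` expand distances on `A`, so its inverse is 1-Lipschitz and `g` is a
  -- Lipschitz function of `T x`.
  set T : ℝ → ℝ := fun x => g x + (C + 1) * x with hT
  have hexp : ∀ x ∈ A, ∀ x' ∈ A, |x' - x| ≤ |T x' - T x| := by
    have aux : ∀ x ∈ A, ∀ x' ∈ A, x < x' → |x' - x| ≤ |T x' - T x| := by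
      intro x hx x' hx' hlt
      have := h x hx x' hx' hlt
      rw [abs_of_pos (by linarith)]
      refine le_trans ?_ (le_abs_self _)
      simp only [hT]
      linarith
    intro x hx x' hx'
    rcases lt_trichotomy x x' with hlt | rfl | hlt
    · exact aux x hx x' hx' hlt
    · simp
    · rw [abs_sub_comm, abs_sub_comm (T x')]
      exact aux x' hx' x hx hlt
  have hinj : Set.InjOn T A := by
    intro x hx x' hx' e
    have := hexp x hx x' hx'
    rw [e, sub_self, abs_zero] at this
    exact (sub_eq_zero.1 (abs_nonpos_iff.1 this)).symm
  have hlip : LipschitzOnWith 1 (Function.invFunOn T A) (T '' A) := by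
    refine LipschitzOnWith.of_dist_le_mul ?_
    rintro _ ⟨x, hx, rfl⟩ _ ⟨x', hx', rfl⟩
    rw [hinj.leftInvOn_invFunOn hx, hinj.leftInvOn_invFunOn hx', NNReal.coe_one, one_mul,
      Real.dist_eq, Real.dist_eq]
    exact hexp x' hx' x hx
  obtain ⟨S, hS, hSe⟩ := hlip.extend_real
  have hST : ∀ x ∈ A, S (T x) = x := fun x hx => by
    rw [← hSe ⟨x, hx, rfl⟩, hinj.leftInvOn_invFunOn hx]
  have hψ : LipschitzWith (1 + ‖(C + 1 : ℝ)‖₊ * 1) fun t => t - (C + 1) * S t :=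
    LipschitzWith.id.sub ((lipschitzWith_smul (C + 1 : ℝ)).comp hS)
  filter_upwards [LipschitzWith.ae_finite_level hψ (-M + (C + 1) * a) (M + (C + 1) * b)] with y hy
  refine Set.Finite.of_finite_image (hy.subset ?_) (hinj.mono Set.inter_subset_left)
  rintro _ ⟨x, ⟨hx, hxy⟩, rfl⟩
  have := abs_le.1 (hg x hx)
  have h3 := hA hx
  refine ⟨⟨?_, ?_⟩, ?_⟩
  · simp only [hT]; nlinarith [h3.1]
  · simp only [hT]; nlinarith [h3.2]
  · simp only [Set.mem_ofPred_eq, hST x hx]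
    rw [← show g x = y from hxy]
    simp only [hT]; ring

/-! ### Zero-one law and unboundedness of the walk -/

theorem measurable_sg : Measurable sg :=
  Measurable.ite (measurableSet_lt measurable_fract measurable_const) measurable_const
    measurable_const

theorem measurable_slope (r n : ℕ) : Measurable (slope r n) :=
  Finset.measurable_sum _ fun _ _ => measurable_sg.comp (measurable_const_mul _)

/-- A periodic set which contains its preimage under multiplication by `r` is null or conull. -/
theorem ae_mem_or_ae_notMem_of_mul {r : ℕ} (hr : 2 ≤ r) {E : Set ℝ} (hE : MeasurableSet E)
    (hper : ∀ (x : ℝ) (m : ℤ), x + m ∈ E ↔ x ∈ E) (hmul : ∀ x : ℝ, (r : ℝ) * x ∈ E → x ∈ E) :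
    (∀ᵐ x : ℝ, x ∈ E) ∨ ∀ᵐ x : ℝ, x ∉ E := by
  let E' : Set UnitAddCircle := {q | ((AddCircle.measurableEquivIco 1 0 q : ℝ)) ∈ E}
  have hE' : MeasurableSet E' :=
    (measurable_subtype_coe.comp (AddCircle.measurableEquivIco 1 0).measurable) hE
  have hmk : ∀ x : ℝ, (x : UnitAddCircle) ∈ E' ↔ x ∈ E := by
    intro x
    have e : ((AddCircle.measurableEquivIco 1 0 (x : UnitAddCircle) : ℝ)) = Int.fract x := by
      have : ((AddCircle.measurableEquivIco 1 0 (x : UnitAddCircle) : ℝ)) =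
        toIcoMod (zero_lt_one' ℝ) 0 x := rfl
      rw [this, toIcoMod_zero_one]
    change ((AddCircle.measurableEquivIco 1 0 (x : UnitAddCircle) : ℝ)) ∈ E ↔ _
    rw [e, ← hper (Int.fract x) ⌊x⌋, Int.fract_add_floor]
  have herg : Ergodic fun q : UnitAddCircle => r • q := AddCircle.ergodic_nsmul (by omega)
  have hsub : (fun q : UnitAddCircle => r • q) ⁻¹' E' ⊆ E' := by
    intro q hq
    induction q using QuotientAddGroup.induction_on with
    | H x =>
      refine (hmk x).2 (hmul x ((hmk _).1 ?_))
      have e : (((r : ℝ) * x : ℝ) : UnitAddCircle) = r • (x : UnitAddCircle) := by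
        rw [← nsmul_eq_mul]; rfl
      rw [e]
      exact hq
  have hpull : ∀ s : Set UnitAddCircle, (∀ᵐ q, q ∈ s) → ∀ᵐ x : ℝ, (x : UnitAddCircle) ∈ s := by
    intro s hs
    rw [← Measure.restrict_univ (μ := (volume : Measure ℝ)), ← iUnion_Ioc_intCast ℝ,
      ae_restrict_iUnion_iff]
    intro k
    exact (AddCircle.measurePreserving_mk 1 (k : ℝ)).quasiMeasurePreserving.ae hs
  rcases herg.ae_empty_or_univ_of_preimage_ae_le hE'.nullMeasurableSet
    (Filter.Eventually.of_forall hsub) with h | h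
  · right
    have h' : ∀ᵐ q, q ∈ E'ᶜ := by
      filter_upwards [h] with q hq hqE
      exact (hq.mp hqE).elim
    filter_upwards [hpull _ h'] with x hx hxE
    exact hx ((hmk x).2 hxE)
  · left
    have h' : ∀ᵐ q, q ∈ E' := by
      filter_upwards [h] with q hq
      exact hq.mpr trivial
    filter_upwards [hpull _ h'] with x hx
    exact (hmk x).1 hx

theorem not_ae_notMem_of_Ioo_subset {E : Set ℝ} {a b : ℝ} (hab : a < b) (h : Set.Ioo a b ⊆ E) :
    ¬ ∀ᵐ x : ℝ, x ∉ E := by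
  intro h'
  have h0 : volume E = 0 := measure_eq_zero_iff_ae_notMem.2 h'
  have := measure_mono_null h h0
  rw [Real.volume_Ioo, ENNReal.ofReal_eq_zero] at this
  linarith

/-- Almost every real has arbitrarily long runs of the digit zero. -/
theorem ae_exists_fract_lt {r : ℕ} (hr : 2 ≤ r) {ε : ℝ} (hε : 0 < ε) :
    ∀ᵐ x : ℝ, ∃ k : ℕ, Int.fract ((r : ℝ) ^ k * x) < ε := by
  refine (ae_mem_or_ae_notMem_of_mul hr (E := {x : ℝ | ∃ k : ℕ, Int.fract ((r : ℝ) ^ k * x) < ε})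
    ?_ ?_ ?_).resolve_right ?_
  · have : {x : ℝ | ∃ k : ℕ, Int.fract ((r : ℝ) ^ k * x) < ε} =
        ⋃ k : ℕ, {x : ℝ | Int.fract ((r : ℝ) ^ k * x) < ε} := by ext; simp
    rw [this]
    exact MeasurableSet.iUnion fun k => measurableSet_lt
      (measurable_fract.comp (measurable_const_mul _)) measurable_const
  · intro x m
    refine exists_congr fun k => ?_
    have : (r : ℝ) ^ k * (x + m) = (r : ℝ) ^ k * x + ((r ^ k * m : ℤ) : ℝ) := by
      push_cast; ring
    rw [this, Int.fract_add_intCast]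
  · rintro x ⟨k, hk⟩
    exact ⟨k + 1, by rw [pow_succ, mul_assoc]; exact hk⟩
  · refine not_ae_notMem_of_Ioo_subset (a := 0) (b := min ε 1) (lt_min hε one_pos) ?_
    rintro x ⟨h0, h1⟩
    refine ⟨0, ?_⟩
    rw [pow_zero, one_mul, Int.fract_eq_self.2 ⟨h0.le, h1.trans_le (min_le_right _ _)⟩]
    exact h1.trans_le (min_le_left _ _)

theorem slope_of_fract_lt {r : ℕ} (hr : 2 ≤ r) {x : ℝ} {n : ℕ}
    (h : Int.fract x < (2 * (r : ℝ) ^ n)⁻¹) : slope r n x = n := by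
  have h2 : (1 : ℝ) ≤ r := by exact_mod_cast (by omega : 1 ≤ r)
  rw [← Int.fract_add_floor x, slope_add_intCast, slope]
  have : ∀ k ∈ Finset.range n, sg ((r : ℝ) ^ k * Int.fract x) = 1 := by
    intro k hk
    refine sg_eq_one (m := 0) (by simpa using mul_nonneg (by positivity) (Int.fract_nonneg x)) ?_
    have h3 : (r : ℝ) ^ k ≤ (r : ℝ) ^ n := pow_le_pow_right₀ h2 (Finset.mem_range.1 hk).le
    have h4 : (r : ℝ) ^ k * Int.fract x ≤ (r : ℝ) ^ n * Int.fract x :=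
      mul_le_mul_of_nonneg_right h3 (Int.fract_nonneg x)
    have h5 : (r : ℝ) ^ n * Int.fract x < (r : ℝ) ^ n * (2 * (r : ℝ) ^ n)⁻¹ :=
      mul_lt_mul_of_pos_left h (by positivity)
    have h6 : (r : ℝ) ^ n * (2 * (r : ℝ) ^ n)⁻¹ = 1 / 2 := by field_simp
    push_cast
    linarith
  rw [Finset.sum_congr rfl this]
  simp

/-- The set of points with slopes unbounded above. -/
def unboundedSlope (r : ℕ) : Set ℝ := {x | ∀ M : ℕ, ∃ n, (M : ℤ) < slope r n x}

theorem ae_nonGrid {r : ℕ} (hr : 2 ≤ r) : ∀ᵐ x : ℝ, NonGrid r x := by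
  have := (countable_not_nonGrid r hr).measure_zero volume
  exact this

/-- Otherwise, by the zero-one law and the symmetry x ↦ -x, almost every walk is bounded on both
sides, contradicting its arbitrarily long runs of +1 steps. -/
theorem ae_mem_unboundedSlope {r : ℕ} (hr : 2 ≤ r) : ∀ᵐ x : ℝ, x ∈ unboundedSlope r := by
  refine (ae_mem_or_ae_notMem_of_mul hr (E := unboundedSlope r) ?_ ?_ ?_).resolve_right ?_
  · have : unboundedSlope r = ⋂ M : ℕ, ⋃ n, {x | (M : ℤ) < slope r n x} := by
      ext; simp [unboundedSlope]
    rw [this]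
    exact MeasurableSet.iInter fun M => MeasurableSet.iUnion fun n =>
      measurableSet_lt measurable_const (measurable_slope r n)
  · intro x m
    simp only [unboundedSlope, Set.mem_ofPred_eq, slope_add_intCast]
  · intro x hx M
    obtain ⟨n, hn⟩ := hx (M + 1)
    refine ⟨n + 1, ?_⟩
    rw [slope_succ']
    push_cast at hn
    rcases sg_eq_one_or x with e | e <;> omega
  · intro h
    have hneg : ∀ᵐ x : ℝ, -x ∉ unboundedSlope r :=
      (Measure.measurePreserving_neg (volume : Measure ℝ)).quasiMeasurePreserving.ae h
    have hrun : ∀ᵐ x : ℝ, ∀ M : ℕ, ∃ k : ℕ,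
        Int.fract ((r : ℝ) ^ k * x) < (2 * (r : ℝ) ^ M)⁻¹ := by
      rw [ae_all_iff]
      intro M
      have : (0 : ℝ) < r := by exact_mod_cast (by omega : 0 < r)
      exact ae_exists_fract_lt hr (by positivity)
    have hfalse : ∀ᵐ _ : ℝ, False := by
      filter_upwards [h, hneg, hrun, ae_nonGrid hr] with x h1 h2 h3 h4
      simp only [unboundedSlope, Set.mem_ofPred_eq, not_forall, not_exists, not_lt] at h1 h2
      obtain ⟨M, hM⟩ := h1
      obtain ⟨M', hM'⟩ := h2
      obtain ⟨k, hk⟩ := h3 (M + M' + 1)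
      have e := slope_add r k (M + M' + 1) x
      rw [slope_of_fract_lt hr hk] at e
      have a := hM (k + (M + M' + 1))
      have b := hM' k
      rw [slope_neg h4] at b
      push_cast at e
      omega
    rw [ae_iff] at hfalse
    simp at hfalse

/-! ### Recurrence -/

/-- The points whose slopes vanish infinitely often. -/
def recurrentSet (r : ℕ) : Set ℝ := {x | ∀ N, ∃ n ≥ N, slope r n x = 0}

/-- Between zeros the slopes have constant sign. -/
theorem slope_pos_of_ne_zero {r : ℕ} {x : ℝ} {N : ℕ} (h : ∀ n ≥ N, slope r n x ≠ 0)
    (hN : 0 < slope r N x) {n : ℕ} (hn : N ≤ n) : 0 < slope r n x := by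
  induction n, hn using Nat.le_induction with
  | base => exact hN
  | succ n hn ih =>
    have := h (n + 1) (by omega)
    rcases slope_succ_eq r n x with e | e <;> omega

theorem neg_le_slope (r n : ℕ) (x : ℝ) : -(n : ℤ) ≤ slope r n x := by
  induction n with
  | zero => simp [slope_zero]
  | succ n ih => rcases slope_succ_eq r n x with e | e <;> push_cast <;> omega

/-- Before time `N` the walk has taken fewer than `N` steps, so the time itself serves as the bound.
-/
theorem neg_le_slope_of_pos {r : ℕ} {x : ℝ} {N : ℕ} (h : ∀ n ≥ N, 0 ≤ slope r n x) (j : ℕ) :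
    0 ≤ N + slope r j x := by
  have := neg_le_slope r j x
  rcases le_total N j with hj | hj
  · have := h j hj; omega
  · omega

/-- The slopes at a non-recurrent point are eventually positive or eventually negative. -/
theorem eventually_pos_or_neg {r : ℕ} {x : ℝ} (hx : NonGrid r x) (h : x ∉ recurrentSet r) :
    (∃ N, ∀ n ≥ N, 0 < slope r n x) ∨ ∃ N, ∀ n ≥ N, 0 < slope r n (-x) := by
  simp only [recurrentSet, Set.mem_ofPred_eq, not_forall, not_exists, not_and] at h
  obtain ⟨N, hN⟩ := h
  rcases lt_or_gt_of_ne (hN N le_rfl) with h0 | h0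
  · right
    refine ⟨N, fun n hn => slope_pos_of_ne_zero (N := N) (fun n hn => ?_) ?_ hn⟩
    · rw [slope_neg hx]; simpa using hN n hn
    · rw [slope_neg hx]; omega
  · exact Or.inl ⟨N, fun n hn => slope_pos_of_ne_zero hN h0 hn⟩

theorem ae_neg_mem_unboundedSlope {r : ℕ} (hr : 2 ≤ r) : ∀ᵐ x : ℝ, -x ∈ unboundedSlope r :=
  (Measure.measurePreserving_neg (volume : Measure ℝ)).quasiMeasurePreserving.ae
    (ae_mem_unboundedSlope hr)

theorem ae_mem_recurrentSet {r : ℕ} (hr : 2 ≤ r) : ∀ᵐ x : ℝ, x ∈ recurrentSet r := by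
  filter_upwards [ae_nonGrid hr, ae_mem_unboundedSlope hr, ae_neg_mem_unboundedSlope hr]
    with x h1 h2 h3
  by_contra hx
  rcases eventually_pos_or_neg h1 hx with ⟨N, hN⟩ | ⟨N, hN⟩
  · obtain ⟨n, hn⟩ := h3 N
    have := neg_le_slope_of_pos (fun n hn => (hN n hn).le) n
    rw [slope_neg h1] at hn
    omega
  · obtain ⟨n, hn⟩ := h2 N
    have := neg_le_slope_of_pos (fun n hn => (hN n hn).le) n
    rw [slope_neg h1] at this
    omega

theorem exists_pow_inv_lt {r : ℕ} (hr : 2 ≤ r) {ε : ℝ} (hε : 0 < ε) (N : ℕ) :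
    ∃ n ≥ N, (r : ℝ) * ((r : ℝ) ^ n)⁻¹ < ε := by
  have h2 : (2 : ℝ) ≤ r := by exact_mod_cast hr
  have h1 : Filter.Tendsto (fun n : ℕ => (r : ℝ) * ((r : ℝ)⁻¹) ^ n) Filter.atTop
      (nhds ((r : ℝ) * 0)) :=
    (tendsto_pow_atTop_nhds_zero_of_lt_one (by positivity)
      (inv_lt_one_of_one_lt₀ (by linarith))).const_mul _
  rw [mul_zero] at h1
  obtain ⟨n, hn, hn'⟩ :=
    ((h1.eventually (gt_mem_nhds hε)).and (Filter.eventually_ge_atTop N)).exists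
  exact ⟨n, hn', by rwa [inv_pow] at hn⟩

/-! ### The image of the recurrent points is null -/

/-- A union of cells on which the slope vanishes has an image of comparable measure. -/
theorem volume_image_le {r : ℕ} (hr : 2 ≤ r) {m : ℕ} {E : Set ℝ} (hE : MeasurableSet E)
    (hcell : ∀ x ∈ E, ∀ x', SameCell r m x x' → x' ∈ E) (h0 : ∀ x ∈ E, slope r m x = 0) :
    volume (f r '' E) ≤ 2 * volume E := by
  have h2 : (2 : ℝ) ≤ r := by exact_mod_cast hr
  -- Cells have length `1 / c`, while `f r` varies there by at most r^{-m} ≤ 1/c; the two-sided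
  -- interval around one value gives the factor 2.
  obtain ⟨c, hc0, hcm, hc⟩ : ∃ c : ℝ, 0 < c ∧ c ≤ (r : ℝ) ^ m ∧
      ∀ x x', ⌊c * x⌋ = ⌊c * x'⌋ → SameCell r m x x' := by
    rcases m with _ | k
    · exact ⟨1, one_pos, by simp, fun x x' h => ⟨by simpa using h, fun k hk => by omega⟩⟩
    · refine ⟨2 * (r : ℝ) ^ k, by positivity, ?_, fun x x' h => sameCell_succ hr ?_⟩
      · rw [pow_succ, mul_comm]; gcongr
      · rwa [← mul_assoc, ← mul_assoc]
  have hI : ∀ i : ℤ, {x : ℝ | ⌊c * x⌋ = i} = Set.Ico (i / c) ((i + 1) / c) := by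
    intro i
    ext x
    simp only [Set.mem_ofPred_eq, Int.floor_eq_iff, Set.mem_Ico, div_le_iff₀ hc0,
      lt_div_iff₀ hc0, mul_comm x c]
  have hIm : ∀ i : ℤ, MeasurableSet {x : ℝ | ⌊c * x⌋ = i} := fun i => by
    rw [hI]; exact measurableSet_Ico
  have hdec : E = ⋃ i : ℤ, E ∩ {x : ℝ | ⌊c * x⌋ = i} := by
    ext x; simp
  have hpiece : ∀ i : ℤ, volume (f r '' (E ∩ {x : ℝ | ⌊c * x⌋ = i})) ≤
      2 * volume (E ∩ {x : ℝ | ⌊c * x⌋ = i}) := by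
    intro i
    rcases (E ∩ {x : ℝ | ⌊c * x⌋ = i}).eq_empty_or_nonempty with he | ⟨x, hx, hxi⟩
    · simp [he]
    · have hxi' : ⌊c * x⌋ = i := hxi
      have hsub : {x : ℝ | ⌊c * x⌋ = i} ⊆ E := fun x' hx' =>
        hcell x hx x' (hc x x' (hxi'.trans (Eq.symm hx')))
      rw [Set.inter_eq_right.2 hsub]
      have himg : f r '' {x : ℝ | ⌊c * x⌋ = i} ⊆ Set.Icc (f r x - c⁻¹) (f r x + c⁻¹) := by
        rintro _ ⟨x', hx', rfl⟩
        have e := (hc x x' (hxi'.trans (Eq.symm hx'))).f_sub hr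
        rw [h0 x hx, Int.cast_zero, zero_mul, zero_add] at e
        have e1 : |f r x' - f r x| ≤ c⁻¹ := by
          have b1 : |f r ((r : ℝ) ^ m * x') - f r ((r : ℝ) ^ m * x)| ≤ 1 := by
            rw [abs_le]
            constructor <;> linarith [f_nonneg r ((r : ℝ) ^ m * x'), f_nonneg r ((r : ℝ) ^ m * x),
              f_le_one r hr ((r : ℝ) ^ m * x'), f_le_one r hr ((r : ℝ) ^ m * x)]
          rw [e, abs_mul, abs_of_nonneg (by positivity)]
          exact (mul_le_of_le_one_right (by positivity) b1).trans (inv_anti₀ hc0 hcm)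
        rw [abs_le] at e1
        constructor <;> linarith [e1.1, e1.2]
      refine (measure_mono himg).trans ?_
      rw [hI, Real.volume_Icc, Real.volume_Ico, ← ENNReal.ofReal_ofNat 2,
        ← ENNReal.ofReal_mul (by norm_num)]
      refine ENNReal.ofReal_le_ofReal (le_of_eq ?_)
      field_simp
      ring
  calc volume (f r '' E) = volume (⋃ i : ℤ, f r '' (E ∩ {x : ℝ | ⌊c * x⌋ = i})) := by
        rw [← Set.image_iUnion, ← hdec]
    _ ≤ ∑' i : ℤ, volume (f r '' (E ∩ {x : ℝ | ⌊c * x⌋ = i})) := measure_iUnion_le _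
    _ ≤ ∑' i : ℤ, 2 * volume (E ∩ {x : ℝ | ⌊c * x⌋ = i}) := ENNReal.tsum_le_tsum hpiece
    _ = 2 * volume E := by
        rw [ENNReal.tsum_mul_left, ← measure_iUnion, ← hdec]
        · intro i j hij
          refine Set.disjoint_left.2 fun x hx hx' => hij ?_
          exact Eq.trans (Eq.symm hx.2) hx'.2
        · exact fun i => hE.inter (hIm i)

/-- Points of the unit interval whose first `n` slopes are nonnegative. -/
def nonnegUpTo (r n : ℕ) : Set ℝ := {x | x ∈ Set.Ico (0 : ℝ) 1 ∧ ∀ j ≤ n, 0 ≤ slope r j x}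

/-- Points of `nonnegUpTo r n` whose first zero of the slope from `n` on is at `m`. -/
def firstZero (r n m : ℕ) : Set ℝ :=
  {x | x ∈ nonnegUpTo r n ∧ n ≤ m ∧ slope r m x = 0 ∧ ∀ j, n ≤ j → j < m → slope r j x ≠ 0}

theorem measurableSet_nonnegUpTo (r n : ℕ) : MeasurableSet (nonnegUpTo r n) := by
  have : nonnegUpTo r n = Set.Ico 0 1 ∩ ⋂ j, ⋂ (_ : j ≤ n), {x | 0 ≤ slope r j x} := by
    ext; simp [nonnegUpTo]
  rw [this]
  exact measurableSet_Ico.inter (MeasurableSet.iInter fun j => MeasurableSet.iInter fun _ =>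
    measurableSet_le measurable_const (measurable_slope r j))

theorem measurableSet_firstZero (r n m : ℕ) : MeasurableSet (firstZero r n m) := by
  by_cases hnm : n ≤ m
  · have : firstZero r n m = nonnegUpTo r n ∩ ({x | slope r m x = 0} ∩
        ⋂ j, ⋂ (_ : n ≤ j), ⋂ (_ : j < m), {x | slope r j x = 0}ᶜ) := by
      ext; simp [firstZero, hnm]; tauto
    rw [this]
    exact (measurableSet_nonnegUpTo r n).inter ((measurableSet_eq_fun (measurable_slope r m)
      measurable_const).inter (MeasurableSet.iInter fun j => MeasurableSet.iInter fun _ =>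
      MeasurableSet.iInter fun _ => (measurableSet_eq_fun (measurable_slope r j)
      measurable_const).compl))
  · have : firstZero r n m = ∅ := by
      ext; simp [firstZero, hnm]
    rw [this]
    exact MeasurableSet.empty

theorem mem_Ico_iff_floor (x : ℝ) : x ∈ Set.Ico (0 : ℝ) 1 ↔ ⌊x⌋ = 0 := by
  rw [Int.floor_eq_zero_iff]

/-- Cutting at the first zero from time `n` on gives disjoint unions of cells with zero slope, to
which `volume_image_le` applies. -/
theorem volume_image_nonnegUpTo_le {r : ℕ} (hr : 2 ≤ r) (n : ℕ) :
    volume (f r '' (nonnegUpTo r n ∩ recurrentSet r)) ≤ 2 * volume (nonnegUpTo r n) := by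
  have hsub : nonnegUpTo r n ∩ recurrentSet r ⊆ ⋃ m, firstZero r n m := by
    classical
    rintro x ⟨hx, hrec⟩
    obtain ⟨m, hm, h0⟩ := hrec n
    have hex : ∃ m, n ≤ m ∧ slope r m x = 0 := ⟨m, hm, h0⟩
    refine Set.mem_iUnion.2 ⟨Nat.find hex, hx, (Nat.find_spec hex).1, (Nat.find_spec hex).2,
      fun j h1 h2 h3 => Nat.find_min hex h2 ⟨h1, h3⟩⟩
  calc volume (f r '' (nonnegUpTo r n ∩ recurrentSet r))
      ≤ volume (⋃ m, f r '' firstZero r n m) := by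
        rw [← Set.image_iUnion]; exact measure_mono (Set.image_mono hsub)
    _ ≤ ∑' m, volume (f r '' firstZero r n m) := measure_iUnion_le _
    _ ≤ ∑' m, 2 * volume (firstZero r n m) := by
        refine ENNReal.tsum_le_tsum fun m => volume_image_le hr (m := m)
          (measurableSet_firstZero r n m) ?_ fun x hx => hx.2.2.1
        rintro x ⟨⟨h1, h2⟩, h3, h4, h5⟩ x' hc
        refine ⟨⟨?_, fun j hj => ?_⟩, h3, ?_, fun j hj hj' => ?_⟩
        · rw [mem_Ico_iff_floor, ← hc.1, ← mem_Ico_iff_floor]; exact h1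
        · rw [hc.slope_eq (by omega)]; exact h2 j hj
        · rw [hc.slope_eq le_rfl]; exact h4
        · rw [hc.slope_eq hj'.le]; exact h5 j hj hj'
    _ = 2 * volume (⋃ m, firstZero r n m) := by
        rw [ENNReal.tsum_mul_left, measure_iUnion _ (measurableSet_firstZero r n)]
        intro m m' hne
        refine Set.disjoint_left.2 fun x hx hx' => ?_
        rcases lt_or_gt_of_ne hne with h | h
        · exact hx'.2.2.2 m hx.2.1 h hx.2.2.1
        · exact hx.2.2.2 m' hx'.2.1 h hx'.2.2.1
    _ ≤ 2 * volume (nonnegUpTo r n) := by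
        gcongr
        exact Set.iUnion_subset fun m x hx => hx.1

theorem tendsto_volume_nonnegUpTo {r : ℕ} (hr : 2 ≤ r) :
    Filter.Tendsto (fun n => volume (nonnegUpTo r n)) Filter.atTop (nhds 0) := by
  have hnull : volume (⋂ n, nonnegUpTo r n) = 0 := by
    rw [measure_eq_zero_iff_ae_notMem]
    filter_upwards [ae_nonGrid hr, ae_neg_mem_unboundedSlope hr] with x h1 h2 hx
    obtain ⟨n, hn⟩ := h2 0
    have := (Set.mem_iInter.1 hx n).2 n le_rfl
    rw [slope_neg h1] at hn
    push_cast at hn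
    omega
  rw [← hnull]
  refine tendsto_measure_iInter_atTop
    (fun n => (measurableSet_nonnegUpTo r n).nullMeasurableSet) ?_ ⟨0, ?_⟩
  · intro n m hnm x hx
    exact ⟨hx.1, fun j hj => hx.2 j (hj.trans hnm)⟩
  · refine ((measure_mono fun x hx => hx.1).trans_lt (?_ : volume (Set.Ico (0 : ℝ) 1) < ⊤)).ne
    simp

/-- Reflection preserves values and the zeros of the walk, so for every `n` each value is also taken
at a recurrent point of `nonnegUpTo r n`. -/
theorem volume_image_recurrentSet {r : ℕ} (hr : 2 ≤ r) :
    volume (f r '' {x | x ∈ Set.Ico (0 : ℝ) 1 ∧ NonGrid r x ∧ x ∈ recurrentSet r}) = 0 := by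
  have hle : ∀ n, volume (f r '' {x | x ∈ Set.Ico (0 : ℝ) 1 ∧ NonGrid r x ∧ x ∈ recurrentSet r}) ≤
      2 * volume (nonnegUpTo r n) := by
    intro n
    refine (measure_mono ?_).trans (volume_image_nonnegUpTo_le hr n)
    rintro _ ⟨x, ⟨h1, h2, h3⟩, rfl⟩
    obtain ⟨x', hc, -, hf, hs, hp⟩ :=
      exists_nonneg_slope hr h2 (N := 0) (by rw [slope_zero]) (Nat.zero_le n)
    refine ⟨x', ⟨⟨?_, fun j hj => hp j (Nat.zero_le j) hj⟩, fun N => ?_⟩, hf⟩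
    · rw [mem_Ico_iff_floor, ← hc.1, ← mem_Ico_iff_floor]; exact h1
    · obtain ⟨m, hm, h0⟩ := h3 N
      refine ⟨m, hm, ?_⟩
      have := hs m
      rwa [h0, abs_zero, abs_eq_zero] at this
  have hlim := ENNReal.Tendsto.const_mul (a := 2) (tendsto_volume_nonnegUpTo hr) (by simp)
  rw [mul_zero] at hlim
  exact le_antisymm (ge_of_tendsto' hlim hle) zero_le

/-! ### Almost every level set is finite -/

theorem ae_finite_level_of_slope {r : ℕ} (hr : 2 ≤ r) (N : ℕ) : ∀ᵐ y : ℝ,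
    ({x | x ∈ Set.Ico (0 : ℝ) 1 ∧ NonGrid r x ∧ ∀ j, 0 ≤ (N : ℤ) + slope r j x} ∩
      {x | f r x = y}).Finite := by
  refine ae_finite_level_of_neg_mul_le (C := N + 2) (a := 0) (b := 1) (M := 1) (by positivity)
    (fun x hx => Set.Ico_subset_Icc_self hx.1) (fun x _ => ?_) ?_
  · rw [abs_of_nonneg (f_nonneg _ _)]; exact f_le_one r hr x
  · rintro x ⟨-, hx, hs⟩ x' ⟨-, hx', hs'⟩ hlt
    obtain ⟨n, -, hn⟩ := exists_pow_inv_lt hr (sub_pos.2 hlt) 0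
    have h2 : (2 : ℝ) ≤ r := by exact_mod_cast hr
    have hpos : (0 : ℝ) < (r : ℝ) ^ n := by positivity
    have := neg_mul_le_f_sub hr n N x x' hx hx' hlt (by
      rw [← div_eq_mul_inv, div_lt_iff₀ hpos] at hn
      linarith) hs hs'
    exact_mod_cast this

/-- A point with eventually positive slopes is isolated in its level set, for generic levels. -/
theorem exists_isolating {r : ℕ} (hr : 2 ≤ r) {x y : ℝ} {N : ℕ}
    (hy : ∀ z, f r z = y → NonGrid r z ∧ z ∉ recurrentSet r) (hx : x ∈ Set.Ico (0 : ℝ) 1)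
    (hxy : f r x = y) (hpos : ∀ n ≥ N, 0 < slope r n x)
    (hfin : ({x | x ∈ Set.Ico (0 : ℝ) 1 ∧ NonGrid r x ∧ ∀ j, 0 ≤ (N : ℤ) + slope r j x} ∩
      {x | f r x = y}).Finite) : ∃ ε > 0, ∀ z, |z - x| < ε → f r z = y → z = x := by
  set F := ({x | x ∈ Set.Ico (0 : ℝ) 1 ∧ NonGrid r x ∧ ∀ j, 0 ≤ (N : ℤ) + slope r j x} ∩
      {x | f r x = y}) \ {x} with hF
  have hFc : IsClosed F := (hfin.subset Set.sdiff_subset).isClosed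
  obtain ⟨δ, hδ, hball⟩ := Metric.isOpen_iff.1 hFc.isOpen_compl x fun h => h.2 rfl
  obtain ⟨n, hn, hnδ⟩ := exists_pow_inv_lt hr hδ N
  -- `n` is chosen so that the order-n cell of `x` misses the finite set `F`; any other point of the
  -- level in this cell will yield a member of `F`.
  have hfar : ∀ z ∈ F, ¬ SameCell r n x z := fun z hz hc =>
    hball (Metric.mem_ball.2 ((hc.dist_le hr).trans_lt hnδ)) hz
  obtain ⟨ε, hε, hcell⟩ := exists_sameCell hr (hy x hxy).1 n
  refine ⟨ε, hε, fun z hz hzy => ?_⟩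
  have hc := hcell z hz
  have hmem : ∀ w, SameCell r n x w → f r w = y → w ≠ x → (∀ j ≥ n, 0 ≤ slope r j w) → w ∈ F := by
    intro w hw hwy hne hs
    refine ⟨⟨⟨?_, (hy w hwy).1, fun j => neg_le_slope_of_pos (fun k hk => ?_) j⟩, hwy⟩, hne⟩
    · rw [mem_Ico_iff_floor, ← hw.1, ← mem_Ico_iff_floor]; exact hx
    · rcases le_total k n with h | h
      · rw [hw.slope_eq h]; exact (hpos k hk).le
      · exact hs k h
  have hzn : 0 < slope r n z := by rw [hc.slope_eq le_rfl]; exact hpos n hn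
  by_contra hne
  by_cases h0 : ∀ m ≥ n, slope r m z ≠ 0
  · exact hfar z (hmem z hc hzy hne fun j hj => (slope_pos_of_ne_zero h0 hzn hj).le) hc
  · push Not at h0
    obtain ⟨m, hm, hm0⟩ := h0
    have hz' := (hy z hzy).2
    simp only [recurrentSet, Set.mem_ofPred_eq, not_forall, not_exists, not_and] at hz'
    obtain ⟨M, hM⟩ := hz'
    -- Beyond `M` the walk of `z` has no zeros, so making it nonnegative up to `max n M` makes it
    -- nonnegative forever after `n`. The zero at `m` survives, which keeps `w` apart from `x`.
    obtain ⟨w, hw, -, hwf, hws, hwp⟩ :=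
      exists_nonneg_slope hr (hy z hzy).1 hzn.le (le_max_left n M)
    have habs : ∀ j, slope r j w = 0 ↔ slope r j z = 0 := fun j => by
      rw [← abs_eq_zero, hws, abs_eq_zero]
    refine hfar w (hmem w (hc.trans hw) (hwf.trans hzy) ?_ fun j hj => ?_) (hc.trans hw)
    · rintro rfl
      have := hpos m (by omega)
      rw [(habs m).2 hm0] at this
      omega
    · rcases le_total j (max n M) with h | h
      · exact hwp j hj h
      · have hM' : ∀ k ≥ max n M, slope r k w ≠ 0 := fun k hk =>
          (habs k).not.2 (hM k (by omega))
        have h1 := hwp (max n M) (by omega) le_rfl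
        have h2 := hM' (max n M) le_rfl
        exact (slope_pos_of_ne_zero hM' (by omega) h).le

theorem ae_finite_levelSet {r : ℕ} (hr : 2 ≤ r) : ∀ᵐ y : ℝ, (levelSet r y).Finite := by
  have hgrid : ∀ᵐ y : ℝ, y ∉ f r '' {x | ¬ NonGrid r x} :=
    measure_eq_zero_iff_ae_notMem.1 (((countable_not_nonGrid r hr).image _).measure_zero _)
  filter_upwards [hgrid, measure_eq_zero_iff_ae_notMem.1 (volume_image_recurrentSet hr),
    ae_all_iff.2 (ae_finite_level_of_slope hr)] with y hy1 hy2 hy3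
  have hng : ∀ z, f r z = y → NonGrid r z := fun z hz => by
    by_contra h
    exact hy1 ⟨z, h, hz⟩
  have hy : ∀ z, f r z = y → NonGrid r z ∧ z ∉ recurrentSet r := by
    refine fun z hz => ⟨hng z hz, fun hrec => hy2 ⟨z + ((-⌊z⌋ : ℤ) : ℝ), ⟨?_, ?_, ?_⟩, ?_⟩⟩
    · rw [mem_Ico_iff_floor, Int.floor_add_intCast]; ring
    · exact (hng z hz).add_intCast _
    · intro N
      simpa only [slope_add_intCast] using hrec N
    · rw [f_add_intCast, hz]
  by_contra hinf
  obtain ⟨x, hx, hacc⟩ := Set.Infinite.exists_accPt_of_subset_isCompact hinf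
    (isCompact_Icc (a := (0 : ℝ)) (b := 1)) fun z hz => Set.Ico_subset_Icc_self hz.1
  have hcl : IsClosed {t | f r t = y} := isClosed_eq (continuous_f r hr) continuous_const
  have hxy : f r x = y := hcl.closure_subset_iff.2 (fun z hz => hz.2)
    (mem_closure_iff_clusterPt.2 hacc.clusterPt)
  have hxg := hng x hxy
  have hx0 : x ≠ 0 := fun e => hxg 0 0 (by simp [e])
  have hx1 : x ≠ 1 := fun e => hxg 0 2 (by simp [e])
  have hxl : 0 < x := lt_of_le_of_ne hx.1 hx0.symm
  have hxr : x < 1 := lt_of_le_of_ne hx.2 hx1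
  have hiso : ∃ ε > 0, ∀ z, |z - x| < ε → f r z = y → z = x := by
    rcases eventually_pos_or_neg hxg (hy x hxy).2 with ⟨N, hN⟩ | ⟨N, hN⟩
    · exact exists_isolating hr hy ⟨hx.1, hxr⟩ hxy hN (hy3 N)
    -- Eventually negative slopes are reduced to positive ones by x ↦ 1 - x.
    · have hf : ∀ z, f r (-z + ((1 : ℤ) : ℝ)) = f r z := fun z => by
        rw [f_add_intCast, f_neg]
      obtain ⟨ε, hε, h⟩ := exists_isolating hr (x := -x + ((1 : ℤ) : ℝ)) (N := N) hy
        ⟨by push_cast; linarith, by push_cast; linarith⟩ ((hf x).trans hxy)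
        (fun n hn => by rw [slope_add_intCast]; exact hN n hn) (hy3 N)
      refine ⟨ε, hε, fun z hz hzy => ?_⟩
      have := h (-z + ((1 : ℤ) : ℝ)) (by
        rw [abs_sub_comm]
        convert hz using 2
        ring) ((hf z).trans hzy)
      linarith
  obtain ⟨ε, hε, h⟩ := hiso
  rw [accPt_iff_nhds] at hacc
  obtain ⟨z, ⟨hz, hzl⟩, hne⟩ := hacc _ (Metric.ball_mem_nhds x hε)
  exact hne (h z (by simpa [Real.dist_eq] using hz) hzl.2)

/-! ### Uncountable level sets -/

theorem not_countable_levelSet {r : ℕ} (hr : 2 ≤ r) {x : ℝ} (hx : x ∈ Set.Ico (0 : ℝ) 1)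
    (hg : NonGrid r x) (hrec : x ∈ recurrentSet r) : ¬ (levelSet r (f r x)).Countable := by
  set P := {z | z ∈ Set.Ico (0 : ℝ) 1 ∧ NonGrid r z ∧ f r z = f r x ∧ z ∈ recurrentSet r} with hP
  have hpre : Preperfect P := by
    rintro z ⟨h1, h2, h3, h4⟩
    rw [accPt_iff_nhds]
    intro U hU
    obtain ⟨ε, hε, hball⟩ := Metric.mem_nhds_iff.1 hU
    obtain ⟨N, -, hN⟩ := exists_pow_inv_lt hr hε 0
    obtain ⟨n, hn, hn0⟩ := h4 N
    obtain ⟨z', hc, hg', hf, hs⟩ := exists_reflection hr h2 hn0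
    refine ⟨z', ⟨hball (((hc.mono hn).dist_le hr).trans_lt hN), ?_, hg', hf.trans h3, ?_⟩, ?_⟩
    · rw [mem_Ico_iff_floor, ← hc.1, ← mem_Ico_iff_floor]; exact h1
    · intro M
      obtain ⟨m, hm, hm0⟩ := h4 (max n M)
      obtain ⟨j, rfl⟩ := Nat.exists_eq_add_of_le (le_of_max_le_left hm)
      exact ⟨n + j, le_of_max_le_right hm, by rw [hs, hm0, neg_zero]⟩
    -- The slope right after the zero is ±1 and changes sign under reflection, so the points differ.
    · rintro rfl
      have := hs 1
      rcases slope_succ_eq r n z' with e | e <;> omega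
  obtain ⟨g, hgr, -, hinj⟩ := hpre.perfect_closure.exists_nat_bool_injection
    ⟨x, subset_closure ⟨hx, hg, rfl, hrec⟩⟩
  have hcl : IsClosed (Set.Icc (0 : ℝ) 1 ∩ {t | f r t = f r x}) :=
    isClosed_Icc.inter (isClosed_eq (continuous_f r hr) continuous_const)
  have hsub : closure P ⊆ Set.Icc (0 : ℝ) 1 ∩ {t | f r t = f r x} :=
    hcl.closure_subset_iff.2 fun z hz => ⟨Set.Ico_subset_Icc_self hz.1, hz.2.2.1⟩
  intro hcount
  -- The closure can leave the level set only at the endpoint 1.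
  have hcount' : (Set.range g).Countable := by
    refine (hcount.union (Set.countable_singleton 1)).mono (hgr.trans (hsub.trans ?_))
    rintro z ⟨hz, hzf⟩
    rcases hz.2.eq_or_lt with e | e
    · exact Or.inr e
    · exact Or.inl ⟨⟨hz.1, e⟩, hzf⟩
  have : Countable (ℕ → Bool) := by
    have h := hcount'.preimage_of_injOn hinj.injOn
    rw [Set.preimage_range, Set.countable_univ_iff] at h
    exact h
  obtain ⟨e, he⟩ := exists_surjective_nat (ℕ → Bool)
  obtain ⟨n, hn⟩ := he fun k => !(e k k)
  have hnn := congrFun hn n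
  simp at hnn

end TakagiVdW

theorem theorem1 (r : ℕ) (hr : 2 ≤ r) :
    (∀ᵐ y : ℝ ∂(volume : Measure ℝ), (TakagiVdW.levelSet r y).Finite) ∧
    (∀ᵐ x : ℝ ∂(volume : Measure ℝ), x ∈ Set.Ico (0 : ℝ) 1 →
      ¬ (TakagiVdW.levelSet r (TakagiVdW.f r x)).Countable) := by
  refine ⟨TakagiVdW.ae_finite_levelSet hr, ?_⟩
  filter_upwards [TakagiVdW.ae_nonGrid hr, TakagiVdW.ae_mem_recurrentSet hr] with x hg hrec hx
  exact TakagiVdW.not_countable_levelSet hr hx hg hrec
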